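/- Let $a>0$ and let $L_1=i\frac{d}{dx}$ on $L^2(-a,a)$ be the minimal operator: its domain consists of those $f\in L^2(-a,a)$ that have a locally absolutely continuous representative with $f'\in L^2(-a,a)$ and $\lim_{x\to\pm a}f(x)=0$. For $w\in\mathbb C$ put $\phi(w;x)=e^{-iwx}$ and $\tilde\phi(\pm i;\cdot)=\phi(\pm i;\cdot)/\|\phi(\pm i;\cdot)\|_{L^2(-a,a)}$. Then $L_1$ is densely defined and, for every nonreal $w$, the function $\phi(w;\cdot)$ spans $\ker(L_1^*-w)$. The Liv\v sic characteristic function of $L_1$ is $$B(w)=\frac{w-i}{w+i}\,A(w,i)^{-1}A(w,-i),\qquad A(w,\pm i)=\langle \phi(w;\cdot),\tilde\phi(\pm i;\cdot)\rangle_{L^2(-a,a)},\qquad w\in\mathbb C_+ ,$$ where the inner product is linear in its first entry. For $\alpha\in\mathbb T$, with complex conjugate $\alpha^*$, let $L_{1,\alpha}$ be the restriction of $L_1^*$ to $\operatorname{dom}L_1+\operatorname{span}\{\alpha\tilde\phi(-i;\cdot)-\tilde\phi(i;\cdot)\}$. The Clark measure of $L_{1,\alpha}$ is the positive Borel measure $\mu$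 on $\mathbb R$ with $\int\frac{d\mu(t)}{1+t^2}<\infty$ for which there is a constant $c\ge 0$ such that, for all $w\in\mathbb C_+$, $$\operatorname{Re}\frac{1+B(w)\alpha^*}{1-B(w)\alpha^*}=c\,\operatorname{Im}w+\int_{\mathbb R}\operatorname{Re}\Bigl(\frac1{i\pi}\,\frac1{t-w}\Bigr)\,d\mu(t).$$ Theorem. For all $w\in\mathbb C_+$ one has $\sin((w+i)a)\neq 0$ and $$B(w)=\frac{\sin((w-i)a)}{\sin((w+i)a)} .$$ For every $\alpha\in\mathbb T$ the Clark measure $\mu$ of $L_{1,\alpha}$ exists and is unique, and the set of its point masses, $\{s\in\mathbb R:\mu(\{s\})\neq0\}$, is exactly $$P_\alpha=\Bigl\{s=\frac1a\tan^{-1}\Bigl(\frac{\alpha^*+1}{\alpha^*-1}\tan(ia)\Bigr)+\frac{n\pi}{a}\;:\;n\in\mathbb Z\Bigr\},$$ where $\tan^{-1}$ is the principal branch, whose argument is real for $\alpha\ne1$, and where for $\alpha=1$ the value of $\tan^{-1}$ is read as $\tan^{-1}(\pm\infty)=\pm\pi/2$ (either sign gives the same set $P_1$). -/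

import Mathlib

open MeasureTheory Set Filter Topology

noncomputable section

namespace ClarkInterval

/-! ### Symmetric operators with deficiency indices `(1, 1)` and their extensions -/

section General

variable {H : Type*} [NormedAddCommGroup H] [InnerProductSpace ℂ H] [CompleteSpace H]

/-- The defect space `ker (T* - w)`, that is, all `f` in the domain of `T*` with `T* f = w f`. -/
def defectSpace (T : H →ₗ.[ℂ] H) (w : ℂ) : Submodule ℂ H :=
  T.adjoint.graph.comap (LinearMap.prod LinearMap.id (w • LinearMap.id))

/-- `T` is densely defined and, for each nonreal `w`, the vector `ψ w` is a basis of the defect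
space `ker (T* - w)`; in particular the deficiency indices of `T` are `(1, 1)`. -/
def IsDefectBasis (T : H →ₗ.[ℂ] H) (ψ : ℂ → H) : Prop :=
  Dense (T.domain : Set H) ∧
    ∀ w : ℂ, w.im ≠ 0 → ψ w ≠ 0 ∧ defectSpace T w = Submodule.span ℂ {ψ w}

/-- The normalized (orthonormal) basis vector of the defect space. -/
def unitDefect (ψ : ℂ → H) (z : ℂ) : H := (‖ψ z‖⁻¹ : ℂ) • ψ z

/-- The analytic Gram matrix (a scalar here) `A(w, z) = ⟨ψ(w), ψ̃(z)⟩`, with the inner product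
linear in the first entry; Mathlib's `inner` is linear in the second one. -/
def gram (ψ : ℂ → H) (w z : ℂ) : ℂ := inner ℂ (unitDefect ψ z) (ψ w)

/-- The characteristic function `B(w) = (w - i) / (w + i) * A(w, i)⁻¹ * A(w, -i)`. -/
def livsic (ψ : ℂ → H) (w : ℂ) : ℂ :=
  (w - Complex.I) / (w + Complex.I) * (gram ψ w Complex.I)⁻¹ * gram ψ w (-Complex.I)

/-- The extension `T_α` of `T`: the restriction of `T*` to `dom T + span {α φ⁻ - φ⁺}`, where
`φ⁺` and `φ⁻` are the normalized basis vectors of `ker (T* - i)` and `ker (T* + i)`. -/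
def extension (T : H →ₗ.[ℂ] H) (ψ : ℂ → H) (α : ℂ) : H →ₗ.[ℂ] H :=
  T.adjoint.domRestrict
    (T.domain ⊔
      Submodule.span ℂ {α • unitDefect ψ (-Complex.I) - unitDefect ψ Complex.I})

end General

/-! ### Clark measures on the real line -/

/-- `μ` is the Clark measure `μ^{B α*}` of `B` on the upper half-plane: it represents the positive
harmonic function `Re ((1 - B α*)⁻¹ (1 + B α*))` through Nevanlinna's formula. -/
def IsClarkMeasure (B : ℂ → ℂ) (α : ℂ) (μ : Measure ℝ) : Prop :=
  Integrable (fun t : ℝ => 1 / (1 + t ^ 2)) μ ∧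
    ∃ c : ℝ, 0 ≤ c ∧ ∀ w : ℂ, 0 < w.im →
      ((1 - B w * star α)⁻¹ * (1 + B w * star α)).re =
        c * w.im + ∫ t : ℝ, (1 / (Complex.I * Real.pi) * (1 / ((t : ℂ) - w))).re ∂μ

/-- `μ` is the Clark measure of the extension `S` of `T` (relative to the defect vectors `ψ`):
`S = T_α` for a unimodular `α`, and `μ = μ^{B α*}` for the characteristic function `B` of `T`. -/
def IsClarkMeasureOf {H : Type*} [NormedAddCommGroup H] [InnerProductSpace ℂ H] [CompleteSpace H]
    (T : H →ₗ.[ℂ] H) (ψ : ℂ → H) (S : H →ₗ.[ℂ] H) (μ : Measure ℝ) : Prop :=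
  IsDefectBasis T ψ ∧
    ∃ α : ℂ, ‖α‖ = 1 ∧ S = extension T ψ α ∧ IsClarkMeasure (livsic ψ) α μ

/-! ### The operator `i d/dx` on `L²(-a, a)` -/

/-- The Hilbert space `L²(-a, a)`. -/
abbrev L2 (a : ℝ) : Type := Lp ℂ 2 (volume.restrict (Ioo (-a) a))

/-- Local absolute continuity on the open interval `(-a, a)`. -/
def ACLoc (a : ℝ) (F : ℝ → ℂ) : Prop :=
  ∀ c ∈ Ioo (-a) a, ∀ d ∈ Ioo (-a) a, AbsolutelyContinuousOnInterval F c d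

/-- The graph of the maximal operator: pairs `(f, g)` in `L²(-a, a)` such that `f` has a locally
absolutely continuous representative `F` with `i F' = g`, that is `F' = -i g`, a.e. -/
def maxGraph (a : ℝ) : Submodule ℂ (L2 a × L2 a) where
  carrier := {p | ∃ F : ℝ → ℂ, ACLoc a F ∧ p.1 =ᵐ[volume.restrict (Ioo (-a) a)] F ∧
    ∀ᵐ x ∂(volume.restrict (Ioo (-a) a)), HasDerivAt F (-Complex.I * p.2 x) x}
  zero_mem' := by
    refine ⟨fun _ => 0, ?_, ?_, ?_⟩
    · intro c _ d _
      simp [AbsolutelyContinuousOnInterval, tendsto_const_nhds]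
    · exact Lp.coeFn_zero _ _ _
    · filter_upwards [Lp.coeFn_zero ℂ 2 (volume.restrict (Ioo (-a) a))] with x hx
      have h : ((0 : L2 a × L2 a).2 : ℝ → ℂ) x = 0 := hx
      rw [h, mul_zero]
      exact hasDerivAt_const x 0
  add_mem' := by
    rintro ⟨f, g⟩ ⟨f', g'⟩ ⟨F, hF, hf, hg⟩ ⟨F', hF', hf', hg'⟩
    refine ⟨F + F', fun c hc d hd => (hF c hc d hd).add (hF' c hc d hd), ?_, ?_⟩
    · exact (Lp.coeFn_add f f').trans (hf.add hf')
    · filter_upwards [hg, hg', Lp.coeFn_add g g'] with x h h' hx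
      have e : (((f, g) + (f', g') : L2 a × L2 a).2 : ℝ → ℂ) x = g x + g' x := hx
      rw [e, mul_add]
      exact h.add h'
  smul_mem' := by
    rintro k ⟨f, g⟩ ⟨F, hF, hf, hg⟩
    refine ⟨fun x => k • F x, fun c hc d hd => (hF c hc d hd).const_smul k, ?_, ?_⟩
    · filter_upwards [Lp.coeFn_smul k f, hf] with x hx h
      have e : ((k • (f, g) : L2 a × L2 a).1 : ℝ → ℂ) x = k • f x := hx
      rw [e]
      exact congrArg (k • ·) h
    · filter_upwards [hg, Lp.coeFn_smul k g] with x h hx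
      have e : ((k • (f, g) : L2 a × L2 a).2 : ℝ → ℂ) x = k • g x := hx
      rw [e]
      have h2 := h.const_smul k
      convert! h2 using 1
      simp only [smul_eq_mul]
      ring

/-- `maxGraph a` is the graph of an operator, so that `maxOp` below is not a default value. -/
theorem maxGraph_singleValued (a : ℝ) (p : L2 a × L2 a) (hp : p ∈ maxGraph a) (h0 : p.1 = 0) :
    p.2 = 0 := by
  obtain ⟨F, hF, hf, hg⟩ := hp
  have hc : ContinuousOn F (Ioo (-a) a) := by
    intro x hx
    obtain ⟨c, hc1, hc2⟩ := exists_between hx.1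
    obtain ⟨d, hd1, hd2⟩ := exists_between hx.2
    have h := (hF c ⟨hc1, hc2.trans hx.2⟩ d ⟨hx.1.trans hd1, hd2⟩).continuousOn
    rw [uIcc_of_le (hc2.trans hd1).le] at h
    exact (h.continuousAt (Icc_mem_nhds hc2 hd1)).continuousWithinAt
  have hF0 : F =ᵐ[volume.restrict (Ioo (-a) a)] fun _ => (0 : ℂ) := by
    rw [h0] at hf
    exact hf.symm.trans (Lp.coeFn_zero _ _ _)
  have hEq : EqOn F (fun _ => 0) (Ioo (-a) a) :=
    Measure.eqOn_open_of_ae_eq hF0 isOpen_Ioo hc continuousOn_const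
  apply (Lp.eq_zero_iff_ae_eq_zero).2
  filter_upwards [hg, ae_restrict_mem measurableSet_Ioo] with x h hx
  have h1 : HasDerivAt F 0 x :=
    (hasDerivAt_const x (0 : ℂ)).congr_of_eventuallyEq
      (hEq.eventuallyEq_of_mem (isOpen_Ioo.mem_nhds hx))
  have h2 := h.unique h1
  simpa using h2

/-- The maximal operator `i d/dx` on `L²(-a, a)`. -/
def maxOp (a : ℝ) : L2 a →ₗ.[ℂ] L2 a := (maxGraph a).toLinearPMap

/-- Elements of `L²(-a, a)` whose continuous representative tends to `0` at both endpoints. -/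
def vanishing (a : ℝ) : Submodule ℂ (L2 a) where
  carrier := {f | ∃ F : ℝ → ℂ, ContinuousOn F (Ioo (-a) a) ∧
    f =ᵐ[volume.restrict (Ioo (-a) a)] F ∧
    Tendsto F (𝓝[>] (-a)) (𝓝 0) ∧ Tendsto F (𝓝[<] a) (𝓝 0)}
  zero_mem' := ⟨fun _ => 0, continuousOn_const, Lp.coeFn_zero _ _ _, tendsto_const_nhds,
    tendsto_const_nhds⟩
  add_mem' := by
    rintro f g ⟨F, hF, hf, h1, h2⟩ ⟨G, hG, hg, k1, k2⟩
    refine ⟨F + G, hF.add hG, (Lp.coeFn_add f g).trans (hf.add hg), ?_, ?_⟩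
    · have h := h1.add k1
      rw [add_zero] at h
      exact h
    · have h := h2.add k2
      rw [add_zero] at h
      exact h
  smul_mem' := by
    rintro k f ⟨F, hF, hf, h1, h2⟩
    refine ⟨fun x => k • F x, hF.const_smul k, ?_, ?_, ?_⟩
    · filter_upwards [Lp.coeFn_smul k f, hf] with x hx h
      rw [hx, Pi.smul_apply, h]
    · simpa using h1.const_smul k
    · simpa using h2.const_smul k

/-- The minimal operator `L₁ = i d/dx` on `L²(-a, a)`: the restriction of the maximal operator to
the functions that vanish at both endpoints. -/
def minOp (a : ℝ) : L2 a →ₗ.[ℂ] L2 a := (maxOp a).domRestrict (vanishing a)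

theorem memLp_exp (a : ℝ) (w : ℂ) :
    MemLp (fun x : ℝ => Complex.exp (-Complex.I * w * x)) 2 (volume.restrict (Ioo (-a) a)) := by
  have hc : Continuous (fun x : ℝ => Complex.exp (-Complex.I * w * x)) := by fun_prop
  obtain ⟨C, hC⟩ := (isCompact_Icc (a := -a) (b := a)).exists_bound_of_continuousOn hc.continuousOn
  refine MemLp.of_bound hc.aestronglyMeasurable C ?_
  filter_upwards [ae_restrict_mem measurableSet_Ioo] with x hx
  exact hC x (Ioo_subset_Icc_self hx)

/-- The solution `x ↦ e^{-iwx}` of `i f' = w f`, as an element of `L²(-a, a)`. -/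
def expVec (a : ℝ) (w : ℂ) : L2 a := (memLp_exp a w).toLp _

end ClarkInterval

end

noncomputable section

namespace ClarkInterval

/-! ### Poisson integrals of measures on the real line -/

/-! The inner product of `e^{-izx}` and `e^{-iwx}` over `(-a, a)` is `2 sin((w - conj z)a) / (w -
conj z)`. For `z = ±i` the denominators cancel the prefactor in `B`, and the two norms agree, so `B`
is a quotient of sines (`livsic_expVec`).

With `s = sin(aw)` and `c = cos(aw)`, the Cayley transform of `B α*` is a quotient of two linear
forms in `s` and `c`, which can be written as `i(q + p cot(aw - δ))` with `q` real and `p > 0`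
(`re_cayley_of_eq_one`, `re_cayley_of_ne_one`). Its real part is `-p Im cot(aw - δ)`. By the partial
fraction expansion of the cotangent, this is the Poisson integral of equal masses `pπ/a` at the
points `(δ + nπ)/a`. That gives existence and the location of the atoms.

Uniqueness needs only the case in which one of the two measures is atomic
(`eq_of_poisson_eq_of_countable`): vertical limits of the Poisson integral recover every point mass,
and positivity of the kernel leaves no room for anything else.

On the operator side, integration by parts and a du Bois-Reymond argument identify the defect
spaces. As the Clark measure is attached to the extension and not to `α`, the map from `α` to the
extension must also be injective (`extension_minOp_injective`). -/

theorem poisson_kernel_eq (t : ℝ) (w : ℂ) :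
    (1 / (Complex.I * Real.pi) * (1 / ((t : ℂ) - w))).re =
      w.im / (Real.pi * ((t - w.re) ^ 2 + w.im ^ 2)) := by
  have hpi : (Real.pi : ℝ) ≠ 0 := Real.pi_ne_zero
  have h : (1 / (Complex.I * Real.pi) * (1 / ((t : ℂ) - w))) =
      ((1 / Real.pi : ℝ) : ℂ) * (-Complex.I * ((t : ℂ) - w)⁻¹) := by
    have : (Complex.I * Real.pi)⁻¹ = (Real.pi : ℂ)⁻¹ * -Complex.I := by
      rw [mul_inv, Complex.inv_I, mul_comm]
    rw [one_div, one_div, this]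
    push_cast
    ring
  rw [h, Complex.re_ofReal_mul]
  simp only [Complex.neg_re, Complex.mul_re, Complex.neg_im, Complex.I_re, Complex.I_im,
    Complex.inv_re, Complex.inv_im, Complex.sub_re, Complex.sub_im, Complex.ofReal_re,
    Complex.ofReal_im, Complex.normSq_apply]
  rw [show (t - w.re) * (t - w.re) + (0 - w.im) * (0 - w.im) =
    (t - w.re) ^ 2 + w.im ^ 2 by ring]
  rw [one_div, div_mul_eq_div_div, ← div_eq_inv_mul]
  rw [div_right_comm]
  ring_nf

theorem poisson_kernel_pos (t : ℝ) {w : ℂ} (hw : 0 < w.im) :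
    0 < (1 / (Complex.I * Real.pi) * (1 / ((t : ℂ) - w))).re := by
  rw [poisson_kernel_eq]
  have := Real.pi_pos
  positivity

/-- Follows from `t² ≤ 2(t - Re w)² + 2(Re w)²`. The extra factor `w.im` keeps the bound uniform as
`w` approaches the real line, as dominated convergence requires. -/
theorem poisson_kernel_le (t : ℝ) {w : ℂ} (hw : 0 < w.im) :
    w.im * (w.im / (Real.pi * ((t - w.re) ^ 2 + w.im ^ 2))) ≤
      (1 + 2 * w.re ^ 2 + 2 * w.im ^ 2) / Real.pi * (1 / (1 + t ^ 2)) := by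
  have hpi := Real.pi_pos
  rw [← mul_div_assoc, div_mul_div_comm, mul_one, div_le_div_iff₀ (by positivity) (by positivity)]
  have key : w.im * w.im * (1 + t ^ 2) ≤
      (1 + 2 * w.re ^ 2 + 2 * w.im ^ 2) * ((t - w.re) ^ 2 + w.im ^ 2) := by
    nlinarith [mul_nonneg (sq_nonneg w.im) (sq_nonneg (t - 2 * w.re)), sq_nonneg (t - w.re),
      mul_nonneg (sq_nonneg w.re) (sq_nonneg (t - w.re)), sq_nonneg (w.im ^ 2)]
  calc w.im * w.im * (Real.pi * (1 + t ^ 2)) = Real.pi * (w.im * w.im * (1 + t ^ 2)) := by ring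
    _ ≤ Real.pi * ((1 + 2 * w.re ^ 2 + 2 * w.im ^ 2) * ((t - w.re) ^ 2 + w.im ^ 2)) := by gcongr
    _ = _ := by ring

theorem measurable_poisson_kernel (w : ℂ) :
    Measurable fun t : ℝ => (1 / (Complex.I * Real.pi) * (1 / ((t : ℂ) - w))).re := by
  fun_prop

theorem integrable_poisson_kernel {μ : Measure ℝ}
    (hμ : Integrable (fun t : ℝ => 1 / (1 + t ^ 2)) μ) {w : ℂ} (hw : 0 < w.im) :
    Integrable (fun t : ℝ => (1 / (Complex.I * Real.pi) * (1 / ((t : ℂ) - w))).re) μ := by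
  refine Integrable.mono'
    (hμ.const_mul ((1 + 2 * w.re ^ 2 + 2 * w.im ^ 2) / Real.pi / w.im))
    (measurable_poisson_kernel w).aestronglyMeasurable (Eventually.of_forall fun t => ?_)
  rw [Real.norm_of_nonneg (poisson_kernel_pos t hw).le, poisson_kernel_eq, div_mul_eq_mul_div,
    le_div_iff₀ hw, mul_comm]
  exact poisson_kernel_le t hw

/-- The point masses of a measure are recovered from its Poisson integral. -/
theorem tendsto_mul_poisson_integral {μ : Measure ℝ}
    (hμ : Integrable (fun t : ℝ => 1 / (1 + t ^ 2)) μ) (s : ℝ) :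
    Tendsto (fun y : ℝ => y * ∫ t : ℝ, (1 / (Complex.I * Real.pi) *
      (1 / ((t : ℂ) - (⟨s, y⟩ : ℂ)))).re ∂μ) (𝓝[>] 0) (𝓝 (μ.real {s} * (1 / Real.pi))) := by
  have hpi := Real.pi_pos
  have hlim : ∫ t, ({s} : Set ℝ).indicator (fun _ => 1 / Real.pi) t ∂μ =
      μ.real {s} * (1 / Real.pi) := by
    rw [integral_indicator_const _ (measurableSet_singleton s), smul_eq_mul]
  rw [← hlim]
  simp_rw [← integral_const_mul]
  -- For `0 < y ≤ 1` the bound of `poisson_kernel_le` no longer depends on `y`. Pointwise, `y` times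
  -- the kernel is constantly `1/π` at `t = s` and tends to `0` elsewhere.
  refine tendsto_integral_filter_of_dominated_convergence
    (fun t => (1 + 2 * s ^ 2 + 2) / Real.pi * (1 / (1 + t ^ 2))) ?_ ?_ (hμ.const_mul _) ?_
  · exact Eventually.of_forall fun y =>
      ((measurable_poisson_kernel ⟨s, y⟩).const_mul y).aestronglyMeasurable
  · filter_upwards [Ioc_mem_nhdsGT (zero_lt_one' ℝ)] with y hy
    refine Eventually.of_forall fun t => ?_
    have hw : 0 < (⟨s, y⟩ : ℂ).im := hy.1
    rw [Real.norm_of_nonneg (mul_nonneg hy.1.le (poisson_kernel_pos t hw).le), poisson_kernel_eq]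
    refine (poisson_kernel_le t hw).trans ?_
    have : y ^ 2 ≤ 1 := pow_le_one₀ hy.1.le hy.2
    have h1 : (1 + 2 * s ^ 2 + 2 * y ^ 2) ≤ (1 + 2 * s ^ 2 + 2) := by linarith
    exact mul_le_mul_of_nonneg_right (div_le_div_of_nonneg_right h1 hpi.le) (by positivity)
  · refine Eventually.of_forall fun t => ?_
    simp_rw [poisson_kernel_eq]
    by_cases hts : t = s
    · subst hts
      rw [indicator_of_mem (mem_singleton t)]
      refine tendsto_const_nhds.congr' ?_
      filter_upwards [self_mem_nhdsWithin] with y hy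
      have : y ≠ 0 := ne_of_gt hy
      simp only [sub_self]
      field_simp
      ring
    · rw [indicator_of_notMem (by simpa using hts)]
      have hne : Real.pi * ((t - s) ^ 2 + 0 ^ 2) ≠ 0 := by
        have : t - s ≠ 0 := sub_ne_zero.2 hts
        positivity
      have hc : ContinuousAt (fun y : ℝ => y * (y / (Real.pi * ((t - s) ^ 2 + y ^ 2)))) 0 := by
        fun_prop (disch := exact hne)
      have := hc.tendsto
      simp only [zero_mul] at this
      exact this.mono_left nhdsWithin_le_nhds

theorem measure_singleton_ne_top {μ : Measure ℝ}
    (hμ : Integrable (fun t : ℝ => 1 / (1 + t ^ 2)) μ) (s : ℝ) : μ {s} ≠ ⊤ := by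
  have h := hμ.measure_norm_ge_lt_top (ε := 1 / (1 + s ^ 2)) (by positivity)
  refine (lt_of_le_of_lt (measure_mono ?_) h).ne
  rintro t rfl
  exact Real.le_norm_self _

/-- Two measures that represent the same function by Nevanlinna's formula have the same point
masses. -/
theorem measure_singleton_eq_of_poisson_eq {μ ν : Measure ℝ} {b c : ℝ}
    (hμ : Integrable (fun t : ℝ => 1 / (1 + t ^ 2)) μ)
    (hν : Integrable (fun t : ℝ => 1 / (1 + t ^ 2)) ν)
    (h : ∀ w : ℂ, 0 < w.im →
      b * w.im + ∫ t : ℝ, (1 / (Complex.I * Real.pi) * (1 / ((t : ℂ) - w))).re ∂μ =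
      c * w.im + ∫ t : ℝ, (1 / (Complex.I * Real.pi) * (1 / ((t : ℂ) - w))).re ∂ν) (s : ℝ) :
    μ {s} = ν {s} := by
  -- After multiplication by `y` the linear terms of the Nevanlinna formula disappear in the limit,
  -- so `b` and `c` need not be compared.
  have hlin : ∀ k : ℝ, Tendsto (fun y : ℝ => y * (k * y)) (𝓝[>] 0) (𝓝 0) := fun k => by
    have hc : ContinuousAt (fun y : ℝ => y * (k * y)) 0 := by fun_prop
    have := hc.tendsto
    simp only [zero_mul] at this
    exact this.mono_left nhdsWithin_le_nhds
  have h1 := (hlin b).add (tendsto_mul_poisson_integral hμ s)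
  have h2 := (hlin c).add (tendsto_mul_poisson_integral hν s)
  have h3 := h1.congr' (f₂ := fun y : ℝ => y * (c * y) + y * ∫ t : ℝ, (1 / (Complex.I * Real.pi) *
      (1 / ((t : ℂ) - (⟨s, y⟩ : ℂ)))).re ∂ν) (by
    filter_upwards [self_mem_nhdsWithin] with y hy
    rw [← mul_add, ← mul_add]
    exact congrArg (y * ·) (h ⟨s, y⟩ hy))
  have h4 := tendsto_nhds_unique h3 h2
  rw [zero_add, zero_add] at h4
  have h5 : μ.real {s} = ν.real {s} :=
    mul_right_cancel₀ (one_div_ne_zero Real.pi_ne_zero) h4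
  exact (ENNReal.toReal_eq_toReal_iff' (measure_singleton_ne_top hμ s)
    (measure_singleton_ne_top hν s)).1 h5

/-- A purely atomic measure is determined by its Poisson integral. -/
theorem eq_of_poisson_eq_of_countable {μ ν : Measure ℝ} {c : ℝ} {S : Set ℝ}
    (hμ : Integrable (fun t : ℝ => 1 / (1 + t ^ 2)) μ)
    (hν : Integrable (fun t : ℝ => 1 / (1 + t ^ 2)) ν) (hc : 0 ≤ c) (hS : S.Countable)
    (hνS : ν Sᶜ = 0)
    (h : ∀ w : ℂ, 0 < w.im →
      c * w.im + ∫ t : ℝ, (1 / (Complex.I * Real.pi) * (1 / ((t : ℂ) - w))).re ∂μ =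
      ∫ t : ℝ, (1 / (Complex.I * Real.pi) * (1 / ((t : ℂ) - w))).re ∂ν) :
    μ = ν := by
  have hsing := measure_singleton_eq_of_poisson_eq (c := 0) hμ hν (by simpa using h)
  have hSm : MeasurableSet S := hS.measurableSet
  have hνr : ν.restrict S = ν :=
    Measure.restrict_eq_self_of_ae_mem (by rwa [ae_iff, ← compl_def])
  have hr : μ.restrict S = ν := by
    rw [← hνr]
    ext A hA
    rw [Measure.restrict_apply hA, Measure.restrict_apply hA]
    have hc : (A ∩ S).Countable := hS.mono inter_subset_right
    rw [← biUnion_of_singleton (A ∩ S),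
      measure_biUnion hc (fun x _ y _ hxy => disjoint_singleton.2 hxy)
        fun x _ => measurableSet_singleton x,
      measure_biUnion hc (fun x _ y _ hxy => disjoint_singleton.2 hxy)
        fun x _ => measurableSet_singleton x]
    simp_rw [hsing]
  -- Once the part of `μ` on `S` is known to be `ν`, the identity at the single point `w = i` reads
  -- `c + ∫_{Sᶜ} = 0`. Both terms are nonnegative and the kernel is strictly positive, so `μ Sᶜ =
  -- 0`.
  have hI : (0 : ℝ) < Complex.I.im := by simp
  have h1 := h Complex.I hI
  have hint := integrable_poisson_kernel hμ hI
  rw [← integral_add_compl hSm hint, hr] at h1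
  have h0 : ∫ t in Sᶜ, (1 / (Complex.I * Real.pi) * (1 / ((t : ℂ) - Complex.I))).re ∂μ = 0 := by
    refine le_antisymm ?_ (integral_nonneg fun t => (poisson_kernel_pos t hI).le)
    have : 0 ≤ c * Complex.I.im := mul_nonneg hc hI.le
    linarith
  have h2 := (integral_eq_zero_iff_of_nonneg (fun t => (poisson_kernel_pos t hI).le)
    hint.integrableOn).1 h0
  have h3 : μ Sᶜ = 0 := by
    rw [← Measure.restrict_eq_zero, ← ae_eq_bot, ← eventually_false_iff_eq_bot]
    filter_upwards [h2] with t ht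
    exact (poisson_kernel_pos t hI).ne' ht
  rw [← hr]
  exact (Measure.restrict_eq_self_of_ae_mem (by rwa [ae_iff, ← compl_def])).symm

/-! ### The partial fraction expansion of the cotangent -/

theorem im_inv_intCast_sub_nonneg (n : ℤ) {z : ℂ} (hz : 0 < z.im) :
    0 ≤ (1 / ((n : ℂ) - z)).im := by
  rw [one_div, Complex.inv_im]
  simp only [Complex.sub_im, Complex.intCast_im, zero_sub, neg_neg]
  exact div_nonneg hz.le (Complex.normSq_nonneg _)

/-- The cotangent series converges only after pairing `n` with `-n`. The imaginary parts are all
nonnegative, so convergence of the paired series forces summability of each half, and the sum over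
`ℤ` is unconditional. -/
theorem hasSum_im_inv_intCast_sub {z : ℂ} (hz : 0 < z.im) :
    HasSum (fun n : ℤ => (1 / ((n : ℂ) - z)).im) (-(Real.pi * Complex.cot (Real.pi * z)).im) := by
  have hz' : z ∈ Complex.integerComplement := by
    rintro ⟨n, rfl⟩
    simp at hz
  have h1 : HasSum (fun n : ℕ => cotTerm z n) (Real.pi * Complex.cot (Real.pi * z) - 1 / z) := by
    rw [cot_series_rep' hz']
    exact (summable_cotTerm hz').hasSum
  set f : ℤ → ℝ := fun n => (1 / ((n : ℂ) - z)).im with hf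
  have hf0 : ∀ n, 0 ≤ f n := fun n => im_inv_intCast_sub_nonneg n hz
  have e1 : ∀ n : ℕ, (1 / (z - ((n : ℂ) + 1))).im = - f (n + 1) := fun n => by
    rw [hf, ← Complex.neg_im]
    push_cast
    rw [← neg_sub z, one_div, one_div, inv_neg, neg_neg]
  have e2 : ∀ n : ℕ, (1 / (z + ((n : ℂ) + 1))).im = - f (-(n + 1)) := fun n => by
    rw [hf, ← Complex.neg_im]
    push_cast
    rw [show -((n : ℂ) + 1) - z = -(z + (n + 1)) by ring, one_div, one_div, inv_neg, neg_neg]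
  have h2 : HasSum (fun n : ℕ => f (n + 1) + f (-(n + 1)))
      (-(Real.pi * Complex.cot (Real.pi * z) - 1 / z).im) := by
    have := (Complex.hasSum_im h1).neg
    refine this.congr_fun ?_
    intro n
    simp only [cotTerm, Complex.add_im, e1, e2]
    ring
  have s1 : Summable fun n : ℕ => f (n + 1) :=
    h2.summable.of_nonneg_of_le (fun n => hf0 _) fun n => le_add_of_nonneg_right (hf0 _)
  have s2 : Summable fun n : ℕ => f (-(n + 1)) :=
    h2.summable.of_nonneg_of_le (fun n => hf0 _) fun n => le_add_of_nonneg_left (hf0 _)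
  have h3 := s1.hasSum.of_add_one_of_neg_add_one s2.hasSum
  have h4 := h2.unique (s1.hasSum.add s2.hasSum)
  convert h3 using 1
  have e0 : f 0 = -(1 / z).im := by
    simp [hf, one_div, neg_div]
  rw [e0, add_right_comm, ← h4, Complex.sub_im]
  ring

/-! ### Measures with equidistant point masses -/

/-- The points `(δ + nπ) / a`. -/
def latticePoint (a δ : ℝ) (n : ℤ) : ℝ := (δ + n * Real.pi) / a

/-- The measure with mass `pπ/a` at each of the points `(δ + nπ) / a`. -/
def latticeMeasure (a p δ : ℝ) : Measure ℝ :=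
  Measure.sum fun n : ℤ => ENNReal.ofReal (p * Real.pi / a) • Measure.dirac (latticePoint a δ n)

variable {a p δ : ℝ}

/-- The substitution `z = (aw - δ)/π` carries the lattice to `ℤ` and reduces the claim to the
cotangent expansion. -/
theorem hasSum_poisson_latticePoint (ha : 0 < a) {w : ℂ} (hw : 0 < w.im) :
    HasSum (fun n : ℤ => p * Real.pi / a *
      (1 / (Complex.I * Real.pi) * (1 / ((latticePoint a δ n : ℂ) - w))).re)
      (-(p * (Complex.cot (a * w - δ)).im)) := by
  have hpi := Real.pi_pos
  have hpi' : (Real.pi : ℂ) ≠ 0 := Complex.ofReal_ne_zero.2 hpi.ne'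
  have ha' : (a : ℂ) ≠ 0 := Complex.ofReal_ne_zero.2 ha.ne'
  set z : ℂ := (a * w - δ) / Real.pi with hzdef
  have hz : 0 < z.im := by
    rw [hzdef, Complex.div_ofReal_im]
    simp only [Complex.sub_im, Complex.im_ofReal_mul, Complex.ofReal_im, sub_zero]
    positivity
  have h := (hasSum_im_inv_intCast_sub hz).mul_left (p / Real.pi)
  have hzz : (Real.pi : ℂ) * z = a * w - δ := by
    rw [hzdef]
    field_simp
  rw [hzz, Complex.im_ofReal_mul] at h
  have hfun : (fun n : ℤ => p * Real.pi / a *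
      (1 / (Complex.I * Real.pi) * (1 / ((latticePoint a δ n : ℂ) - w))).re) =
      fun n : ℤ => p / Real.pi * (1 / ((n : ℂ) - z)).im := by
    funext n
    have h1 : (latticePoint a δ n : ℂ) - w = ((Real.pi / a : ℝ) : ℂ) * ((n : ℂ) - z) := by
      rw [hzdef, latticePoint]
      push_cast
      field_simp
      ring
    have h2 : (1 / (Complex.I * Real.pi) * (1 / ((latticePoint a δ n : ℂ) - w))) =
        ((a / Real.pi ^ 2 : ℝ) : ℂ) * (-Complex.I * (1 / ((n : ℂ) - z))) := by
      rw [h1, one_div, one_div, one_div, mul_inv, mul_inv, Complex.inv_I]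
      push_cast
      rw [inv_div]
      field_simp
    rw [h2, Complex.re_ofReal_mul]
    simp only [neg_mul, Complex.neg_re, Complex.I_mul_re, neg_neg]
    field_simp
  have hval : -(p * (Complex.cot (a * w - δ)).im) =
      p / Real.pi * -(Real.pi * (Complex.cot (a * w - δ)).im) := by
    field_simp
  rw [hfun, hval]
  exact h

theorem integrable_latticeMeasure (ha : 0 < a) (hp : 0 < p) :
    Integrable (fun t : ℝ => 1 / (1 + t ^ 2)) (latticeMeasure a p δ) := by
  have hpi := Real.pi_pos
  refine integrable_sum_dirac (fun _ => ENNReal.ofReal_ne_top) ?_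
  -- The function `1/(1 + t²)` is `π` times the Poisson kernel at `w = i`.
  have h := (hasSum_poisson_latticePoint (p := p) (δ := δ) ha
    (show (0 : ℝ) < Complex.I.im by simp)).summable.mul_left Real.pi
  refine h.congr fun n => ?_
  rw [poisson_kernel_eq, ENNReal.toReal_ofReal (by positivity),
    Real.norm_of_nonneg (by positivity)]
  simp only [Complex.I_re, Complex.I_im, sub_zero]
  field_simp
  ring

theorem integral_poisson_latticeMeasure (ha : 0 < a) (hp : 0 < p) {w : ℂ} (hw : 0 < w.im) :
    ∫ t : ℝ, (1 / (Complex.I * Real.pi) * (1 / ((t : ℂ) - w))).re ∂(latticeMeasure a p δ) =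
      -(p * (Complex.cot (a * w - δ)).im) := by
  have hpi := Real.pi_pos
  rw [latticeMeasure, integral_sum_dirac fun _ => ENNReal.ofReal_ne_top,
    ← (hasSum_poisson_latticePoint (p := p) (δ := δ) ha hw).tsum_eq]
  refine tsum_congr fun n => ?_
  rw [ENNReal.toReal_ofReal (by positivity), smul_eq_mul]

theorem latticeMeasure_compl_range : latticeMeasure a p δ (range (latticePoint a δ))ᶜ = 0 := by
  have hm : MeasurableSet (range (latticePoint a δ))ᶜ :=
    (countable_range _).measurableSet.compl
  rw [latticeMeasure, Measure.sum_apply _ hm, ENNReal.tsum_eq_zero]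
  intro n
  rw [Measure.smul_apply, Measure.dirac_apply' _ hm, indicator_of_notMem (by simp), smul_zero]

theorem setOf_latticeMeasure_singleton_ne_zero (ha : 0 < a) (hp : 0 < p) :
    {s : ℝ | latticeMeasure a p δ {s} ≠ 0} = range (latticePoint a δ) := by
  have hpi := Real.pi_pos
  ext s
  refine ⟨fun h => ?_, ?_⟩
  · by_contra hs
    exact h (measure_mono_null (singleton_subset_iff.2 hs) latticeMeasure_compl_range)
  · rintro ⟨n, rfl⟩ h
    rw [latticeMeasure, Measure.sum_apply _ (measurableSet_singleton _), ENNReal.tsum_eq_zero] at h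
    have h1 := h n
    rw [Measure.smul_apply, Measure.dirac_apply_of_mem (mem_singleton _), smul_eq_mul, mul_one,
      ENNReal.ofReal_eq_zero] at h1
    exact absurd h1 (not_le.2 (by positivity))

/-- If the real part of the Cayley transform of `B α*` is a multiple of the imaginary part of a
cotangent, then `B` has exactly one Clark measure. -/
theorem isClarkMeasure_iff_eq_latticeMeasure {B : ℂ → ℂ} {α : ℂ} (ha : 0 < a) (hp : 0 < p)
    (h : ∀ w : ℂ, 0 < w.im → ((1 - B w * star α)⁻¹ * (1 + B w * star α)).re =
      -(p * (Complex.cot (a * w - δ)).im)) (μ : Measure ℝ) :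
    IsClarkMeasure B α μ ↔ μ = latticeMeasure a p δ := by
  constructor
  · rintro ⟨hμ, c, hc, hcl⟩
    refine eq_of_poisson_eq_of_countable hμ (integrable_latticeMeasure ha hp) hc
      (countable_range (latticePoint a δ)) latticeMeasure_compl_range fun w hw => ?_
    rw [← hcl w hw, h w hw, integral_poisson_latticeMeasure ha hp hw]
  · rintro rfl
    refine ⟨integrable_latticeMeasure ha hp, 0, le_rfl, fun w hw => ?_⟩
    rw [h w hw, integral_poisson_latticeMeasure ha hp hw, zero_mul, zero_add]

/-! ### The characteristic function of the interval -/

theorem sin_ne_zero_of_im_pos {z : ℂ} (hz : 0 < z.im) : Complex.sin z ≠ 0 := by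
  rw [Complex.sin_ne_zero_iff]
  rintro k rfl
  rw [← Complex.ofReal_intCast, ← Complex.ofReal_mul, Complex.ofReal_im] at hz
  exact lt_irrefl _ hz

theorem im_add_I_mul_pos {a : ℝ} (ha : 0 < a) {w : ℂ} (hw : 0 < w.im) :
    0 < ((w + Complex.I) * a).im := by
  rw [Complex.im_mul_ofReal, Complex.add_im, Complex.I_im]
  positivity

theorem im_mul_sub_pos {a : ℝ} (ha : 0 < a) (δ : ℝ) {w : ℂ} (hw : 0 < w.im) :
    0 < (a * w - δ : ℂ).im := by
  rw [Complex.sub_im, Complex.im_ofReal_mul, Complex.ofReal_im, sub_zero]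
  positivity

theorem sin_add_I_mul (a : ℝ) (w : ℂ) : Complex.sin ((w + Complex.I) * a) =
    Complex.sin (a * w) * Real.cosh a + Complex.I * (Complex.cos (a * w) * Real.sinh a) := by
  rw [add_mul, mul_comm w, mul_comm Complex.I, Complex.sin_add_mul_I]
  push_cast
  ring

theorem sin_sub_I_mul (a : ℝ) (w : ℂ) : Complex.sin ((w - Complex.I) * a) =
    Complex.sin (a * w) * Real.cosh a - Complex.I * (Complex.cos (a * w) * Real.sinh a) := by
  rw [sub_mul, mul_comm w, mul_comm Complex.I, Complex.sin_sub, Complex.cos_mul_I,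
    Complex.sin_mul_I]
  push_cast
  ring

theorem inv_one_sub_mul_one_add_eq {N D β : ℂ} (hD : D ≠ 0) :
    (1 - N / D * β)⁻¹ * (1 + N / D * β) = (D + β * N) / (D - β * N) := by
  have h1 : 1 - N / D * β = (D - β * N) / D := by field_simp
  have h2 : 1 + N / D * β = (D + β * N) / D := by field_simp
  rw [h1, h2, inv_div, div_mul_div_comm, mul_comm D, mul_div_mul_right _ _ hD]

theorem re_I_mul_add_mul (q p : ℝ) (z : ℂ) :
    (Complex.I * (q + p * z)).re = -(p * z.im) := by
  simp [Complex.mul_re, Complex.add_im]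

/-- Here the cosine terms cancel in the numerator and the sine terms in the denominator. What
remains is `-i coth(a) tan(aw)`, and `-tan(x) = cot(x - π/2)`. -/
theorem re_cayley_of_eq_one {a : ℝ} (ha : 0 < a) {w : ℂ} (hw : 0 < w.im) :
    ((1 - Complex.sin ((w - Complex.I) * a) / Complex.sin ((w + Complex.I) * a) * 1)⁻¹ *
      (1 + Complex.sin ((w - Complex.I) * a) / Complex.sin ((w + Complex.I) * a) * 1)).re =
      -((Real.cosh a / Real.sinh a) * (Complex.cot (a * w - (Real.pi / 2 : ℝ))).im) := by
  have hsh : (Real.sinh a : ℂ) ≠ 0 := Complex.ofReal_ne_zero.2 (Real.sinh_pos_iff.2 ha).ne'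
  have hc : Complex.cos (a * w) ≠ 0 := by
    have := sin_ne_zero_of_im_pos (im_mul_sub_pos ha (Real.pi / 2) hw)
    push_cast at this
    rw [Complex.sin_sub_pi_div_two] at this
    exact neg_ne_zero.1 this
  rw [← re_I_mul_add_mul 0, inv_one_sub_mul_one_add_eq
    (sin_ne_zero_of_im_pos (im_add_I_mul_pos ha hw)), sin_add_I_mul, sin_sub_I_mul]
  congr 1
  push_cast
  rw [Complex.cot, Complex.sin_sub_pi_div_two, Complex.cos_sub_pi_div_two]
  rw [← Complex.ofReal_cosh, ← Complex.ofReal_sinh]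
  have h2 : (Complex.sin (a * w) * Real.cosh a + Complex.I * (Complex.cos (a * w) * Real.sinh a) -
    1 * (Complex.sin (a * w) * Real.cosh a - Complex.I * (Complex.cos (a * w) * Real.sinh a))) =
    2 * Complex.I * (Complex.cos (a * w) * Real.sinh a) := by ring
  rw [h2, div_eq_iff (mul_ne_zero (by simp) (mul_ne_zero hc hsh))]
  have hI := Complex.I_sq
  field_simp
  linear_combination (2 * Complex.sin (a * w) * Real.cosh a) * hI

/-- The choice of `r` makes the denominator a multiple of `s - r c`, that is, of `sin(aw - arctan
r)`. With `T = tanh a` the quotient is `i(r s/T + T c)/(s - r c)`. -/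
theorem re_cayley_of_ne_one {a : ℝ} (ha : 0 < a) {β : ℂ} (hβ : β ≠ 1) {r : ℝ}
    (hr : (r : ℂ) = (β + 1) / (β - 1) * Complex.tan (Complex.I * a)) {w : ℂ} (hw : 0 < w.im) :
    ((1 - Complex.sin ((w - Complex.I) * a) / Complex.sin ((w + Complex.I) * a) * β)⁻¹ *
      (1 + Complex.sin ((w - Complex.I) * a) / Complex.sin ((w + Complex.I) * a) * β)).re =
      -(((Real.tanh a + r ^ 2 / Real.tanh a) / (1 + r ^ 2)) *
        (Complex.cot (a * w - Real.arctan r)).im) := by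
  set δ := Real.arctan r with hδ
  set T := Real.tanh a with hT
  have hsh : 0 < Real.sinh a := Real.sinh_pos_iff.2 ha
  have hch : 0 < Real.cosh a := Real.cosh_pos a
  have hTeq : T * Real.cosh a = Real.sinh a := by
    rw [hT, Real.tanh_eq_sinh_div_cosh]
    field_simp
  have hT0 : 0 < T := by
    rw [hT, Real.tanh_eq_sinh_div_cosh]
    positivity
  have hTc : (T : ℂ) ≠ 0 := Complex.ofReal_ne_zero.2 hT0.ne'
  have hchc : (Real.cosh a : ℂ) ≠ 0 := Complex.ofReal_ne_zero.2 hch.ne'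
  have hcos : (Real.cos δ : ℂ) ≠ 0 := Complex.ofReal_ne_zero.2 (Real.cos_arctan_pos r).ne'
  have hsinδ : (Real.sin δ : ℂ) = r * Real.cos δ := by
    rw [← Complex.ofReal_mul, ← Real.tan_mul_cos (Real.cos_arctan_pos r).ne', hδ, Real.tan_arctan]
  have hβ1 : β - 1 ≠ 0 := sub_ne_zero.2 hβ
  have hr2 : (1 + r ^ 2 : ℂ) ≠ 0 := by
    have : (1 + r ^ 2 : ℝ) ≠ 0 := by positivity
    exact_mod_cast this
  have hr' : (β - 1) * r = (β + 1) * (T * Complex.I) := by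
    rw [hr, mul_comm Complex.I, Complex.tan_mul_I, ← Complex.ofReal_tanh, ← hT]
    field_simp
  set s := Complex.sin (a * w)
  set c := Complex.cos (a * w)
  have hsin : Complex.sin (a * w - δ) = Real.cos δ * (s - r * c) := by
    rw [Complex.sin_sub, ← Complex.ofReal_sin, ← Complex.ofReal_cos, hsinδ]
    ring
  have hcos' : Complex.cos (a * w - δ) = Real.cos δ * (c + r * s) := by
    rw [Complex.cos_sub, ← Complex.ofReal_sin, ← Complex.ofReal_cos, hsinδ]
    ring
  have hden : s - r * c ≠ 0 := by
    have := sin_ne_zero_of_im_pos (im_mul_sub_pos ha δ hw)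
    rw [hsin] at this
    exact right_ne_zero_of_mul this
  -- The constants solve `r s/T + T c = q(s - r c) + p(c + r s)`: comparing coefficients gives `q +
  -- p r = r/T` and `p - q r = T`. As `q` is real, it does not enter the real part.
  rw [← re_I_mul_add_mul (r / T - (T + r ^ 2 / T) / (1 + r ^ 2) * r), inv_one_sub_mul_one_add_eq
    (sin_ne_zero_of_im_pos (im_add_I_mul_pos ha hw)), sin_add_I_mul, sin_sub_I_mul]
  congr 1
  rw [Complex.cot, hsin, hcos', mul_div_mul_left _ _ hcos, ← hTeq]
  have hI := Complex.I_sq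
  have h1 : s * Real.cosh a + Complex.I * (c * ((T * Real.cosh a : ℝ) : ℂ)) +
      β * (s * Real.cosh a - Complex.I * (c * ((T * Real.cosh a : ℝ) : ℂ))) =
      (1 - β) * Real.cosh a * (Complex.I * (r / T * s + T * c)) := by
    rw [Complex.ofReal_mul]
    field_simp
    linear_combination (s * Complex.I) * hr' + (s * T * (β + 1)) * hI
  have h2 : s * Real.cosh a + Complex.I * (c * ((T * Real.cosh a : ℝ) : ℂ)) -
      β * (s * Real.cosh a - Complex.I * (c * ((T * Real.cosh a : ℝ) : ℂ))) =
      (1 - β) * Real.cosh a * (s - r * c) := by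
    rw [Complex.ofReal_mul]
    linear_combination (-c * Real.cosh a) * hr'
  have h3 : (1 - β) * (Real.cosh a : ℂ) ≠ 0 :=
    mul_ne_zero (by rw [← neg_sub]; exact neg_ne_zero.2 hβ1) hchc
  rw [h1, h2, mul_div_mul_left _ _ h3, div_eq_iff hden]
  push_cast
  field_simp
  ring

/-- For unimodular `β ≠ 1` the argument of the arctangent is real. -/
theorem exists_ofReal_eq_cayley_mul_tan (a : ℝ) {β : ℂ} (hβ : ‖β‖ = 1) :
    ∃ r : ℝ, (r : ℂ) = (β + 1) / (β - 1) * Complex.tan (Complex.I * a) := by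
  have h0 : β ≠ 0 := norm_ne_zero_iff.1 (by rw [hβ]; exact one_ne_zero)
  have hconj : (starRingEnd ℂ) β = β⁻¹ := (Complex.inv_eq_conj hβ).symm
  -- Both factors are purely imaginary, so their product is real. At `β = 1` division by zero gives
  -- the value `0`, which does no harm.
  have h1 : (starRingEnd ℂ) ((β + 1) / (β - 1)) = -((β + 1) / (β - 1)) := by
    simp only [map_div₀, map_add, map_sub, map_one, hconj]
    have e1 : β⁻¹ + 1 = (β + 1) / β := by field_simp; ring
    have e2 : β⁻¹ - 1 = -(β - 1) / β := by field_simp; ring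
    rw [e1, e2, div_div_div_cancel_right₀ h0, div_neg]
  have h2 : (starRingEnd ℂ) (Complex.tan (Complex.I * a)) = -Complex.tan (Complex.I * a) := by
    rw [← Complex.tan_conj, map_mul, Complex.conj_I, Complex.conj_ofReal, neg_mul, Complex.tan_neg]
  obtain ⟨r, hr⟩ := Complex.conj_eq_iff_real.1
    (show (starRingEnd ℂ) ((β + 1) / (β - 1) * Complex.tan (Complex.I * a)) = _ by
      rw [map_mul, h1, h2, neg_mul_neg])
  exact ⟨r, hr.symm⟩

theorem range_latticePoint_arctan {a : ℝ} {z : ℂ} {r : ℝ} (hr : (r : ℂ) = z) :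
    range (latticePoint a (Real.arctan r)) =
      {s : ℝ | ∃ n : ℤ, (s : ℂ) = 1 / a * Complex.arctan z + n * Real.pi / a} := by
  ext s
  refine exists_congr fun n => ?_
  rw [← hr, ← Complex.ofReal_arctan, eq_comm, latticePoint]
  norm_cast
  rw [add_div, one_div_mul_eq_div]

theorem range_latticePoint_pi_div_two {a θ : ℝ} (hθ : θ = Real.pi / 2 ∨ θ = -(Real.pi / 2)) :
    range (latticePoint a (Real.pi / 2)) =
      {s : ℝ | ∃ n : ℤ, s = 1 / a * θ + n * Real.pi / a} := by
  ext s
  rcases hθ with rfl | rfl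
  · refine exists_congr fun n => ?_
    rw [eq_comm, latticePoint, add_div, one_div_mul_eq_div]
  -- The index shifts by one: `π/2 + nπ = -π/2 + (n + 1)π`.
  · refine (Equiv.addRight (1 : ℤ)).exists_congr fun n => ?_
    rw [eq_comm, latticePoint, ← one_div_mul_eq_div a, mul_comm (1 / a)]
    have : (Real.pi / 2 + n * Real.pi) * (1 / a) =
        1 / a * -(Real.pi / 2) + ((Equiv.addRight (1 : ℤ) n : ℤ) : ℝ) * Real.pi / a := by
      simp only [Equiv.coe_addRight, Int.cast_add, Int.cast_one]
      ring
    rw [this]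

open scoped ComplexConjugate

/-! ### The fundamental theorem of calculus for locally absolutely continuous functions -/

theorem absolutelyContinuousOnInterval_comp_of_dist_le {X Y : Type*} [PseudoMetricSpace X]
    [PseudoMetricSpace Y] {f : ℝ → X} {g : X → Y} {c d : ℝ}
    (hf : AbsolutelyContinuousOnInterval f c d) (hg : ∀ x y, dist (g x) (g y) ≤ dist x y) :
    AbsolutelyContinuousOnInterval (fun x => g (f x)) c d :=
  squeeze_zero (fun _ => Finset.sum_nonneg fun _ _ => dist_nonneg)
    (fun _ => Finset.sum_le_sum fun _ _ => hg _ _) hf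

/-- Absolute continuity is available only inside the interval, so the fundamental theorem is applied
from an interior point `m`. Since `q` is integrable up to the endpoints, its primitive is continuous
there, and the two limits of `P` can be subtracted. -/
theorem setIntegral_eq_zero_of_ae_hasDerivAt_real {b c : ℝ} (hbc : b < c) {P q : ℝ → ℝ}
    (hP : ∀ x ∈ Ioo b c, ∀ y ∈ Ioo b c, AbsolutelyContinuousOnInterval P x y)
    (hq : IntegrableOn q (Ioo b c))
    (hd : ∀ᵐ x ∂(volume.restrict (Ioo b c)), HasDerivAt P (q x) x)
    (hb : Tendsto P (𝓝[>] b) (𝓝 0)) (hc : Tendsto P (𝓝[<] c) (𝓝 0)) :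
    ∫ x in Ioo b c, q x = 0 := by
  obtain ⟨m, hm⟩ := exists_between hbc
  have hd' := (ae_restrict_iff' measurableSet_Ioo).1 hd
  have hii : IntervalIntegrable q volume b c :=
    (intervalIntegrable_iff_integrableOn_Ioo_of_le hbc.le).2 hq
  have hftc : ∀ x ∈ Ioo b c, P x = P m + ∫ t in m..x, q t := by
    intro x hx
    have h1 := (hP m hm x hx).integral_deriv_eq_sub
    have h2 : ∫ t in m..x, deriv P t = ∫ t in m..x, q t := by
      refine intervalIntegral.integral_congr_ae ?_
      filter_upwards [hd'] with t ht htm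
      refine (ht ?_).deriv
      have := uIoc_subset_uIcc htm
      exact ordConnected_Ioo.uIcc_subset hm hx this
    linarith
  have hcont := intervalIntegral.continuousOn_primitive_interval' hii
    (Ioo_subset_Icc_self.trans_eq (uIcc_of_le hbc.le).symm hm)
  rw [uIcc_of_le hbc.le] at hcont
  have hlimb : Tendsto (fun x => P m + ∫ t in m..x, q t) (𝓝[>] b)
      (𝓝 (P m + ∫ t in m..b, q t)) := by
    have h := (hcont b (left_mem_Icc.2 hbc.le)).mono Ioo_subset_Icc_self
    rw [ContinuousWithinAt, nhdsWithin_Ioo_eq_nhdsGT hbc] at h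
    exact h.const_add _
  have hlimc : Tendsto (fun x => P m + ∫ t in m..x, q t) (𝓝[<] c)
      (𝓝 (P m + ∫ t in m..c, q t)) := by
    have h := (hcont c (right_mem_Icc.2 hbc.le)).mono Ioo_subset_Icc_self
    rw [ContinuousWithinAt, nhdsWithin_Ioo_eq_nhdsLT hbc] at h
    exact h.const_add _
  have e1 := tendsto_nhds_unique (hb.congr' (by
    filter_upwards [Ioo_mem_nhdsGT hbc] with x hx using hftc x hx)) hlimb
  have e2 := tendsto_nhds_unique (hc.congr' (by
    filter_upwards [Ioo_mem_nhdsLT hbc] with x hx using hftc x hx)) hlimc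
  have hbm : IntervalIntegrable q volume b m := hii.mono_set (by
    rw [uIcc_of_le hbc.le, uIcc_of_le hm.1.le]
    exact Icc_subset_Icc_right hm.2.le)
  have hmc : IntervalIntegrable q volume m c := hii.mono_set (by
    rw [uIcc_of_le hbc.le, uIcc_of_le hm.2.le]
    exact Icc_subset_Icc_left hm.1.le)
  have h3 := intervalIntegral.integral_add_adjacent_intervals hbm hmc
  rw [← integral_Ioc_eq_integral_Ioo, ← intervalIntegral.integral_of_le hbc.le, ← h3,
    intervalIntegral.integral_symm m b]
  linarith

/-- The derivative of a locally absolutely continuous function that vanishes at both endpoints has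
integral zero. -/
theorem setIntegral_eq_zero_of_ae_hasDerivAt {a : ℝ} (ha : 0 < a) {P q : ℝ → ℂ} (hP : ACLoc a P)
    (hq : IntegrableOn q (Ioo (-a) a))
    (hd : ∀ᵐ x ∂(volume.restrict (Ioo (-a) a)), HasDerivAt P (q x) x)
    (hb : Tendsto P (𝓝[>] (-a)) (𝓝 0)) (hc : Tendsto P (𝓝[<] a) (𝓝 0)) :
    ∫ x in Ioo (-a) a, q x = 0 := by
  have hre : ∫ x in Ioo (-a) a, (q x).re = 0 := by
    refine setIntegral_eq_zero_of_ae_hasDerivAt_real (P := fun x => (P x).re) (by linarith)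
      (fun x hx y hy => absolutelyContinuousOnInterval_comp_of_dist_le (hP x hx y hy) fun u v => ?_)
      hq.re ?_ ?_ ?_
    · rw [Real.dist_eq, ← Complex.sub_re, Complex.dist_eq]
      exact Complex.abs_re_le_norm _
    · filter_upwards [hd] with x hx
      exact Complex.reCLM.hasFDerivAt.comp_hasDerivAt x hx
    · exact (Complex.continuous_re.tendsto 0).comp hb
    · exact (Complex.continuous_re.tendsto 0).comp hc
  have him : ∫ x in Ioo (-a) a, (q x).im = 0 := by
    refine setIntegral_eq_zero_of_ae_hasDerivAt_real (P := fun x => (P x).im) (by linarith)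
      (fun x hx y hy => absolutelyContinuousOnInterval_comp_of_dist_le (hP x hx y hy) fun u v => ?_)
      hq.im ?_ ?_ ?_
    · rw [Real.dist_eq, ← Complex.sub_im, Complex.dist_eq]
      exact Complex.abs_im_le_norm _
    · filter_upwards [hd] with x hx
      exact Complex.imCLM.hasFDerivAt.comp_hasDerivAt x hx
    · exact (Complex.continuous_im.tendsto 0).comp hb
    · exact (Complex.continuous_im.tendsto 0).comp hc
  have h := integral_re_add_im (𝕜 := ℂ) hq
  rw [← h]
  have hre' : ∫ x in Ioo (-a) a, RCLike.re (q x) = 0 := hre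
  have him' : ∫ x in Ioo (-a) a, RCLike.im (q x) = 0 := him
  rw [hre', him']
  simp

/-! ### Continuous functions as elements of `L²(-a, a)` -/

theorem memLp_of_continuous (a : ℝ) {k : ℝ → ℂ} (hk : Continuous k) :
    MemLp k 2 (volume.restrict (Ioo (-a) a)) := by
  obtain ⟨C, hC⟩ := (isCompact_Icc (a := -a) (b := a)).exists_bound_of_continuousOn hk.continuousOn
  refine MemLp.of_bound hk.aestronglyMeasurable C ?_
  filter_upwards [ae_restrict_mem measurableSet_Ioo] with x hx
  exact hC x (Ioo_subset_Icc_self hx)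

/-- The element of `L²(-a, a)` given by a continuous function. -/
def ofContinuous (a : ℝ) {k : ℝ → ℂ} (hk : Continuous k) : L2 a := (memLp_of_continuous a hk).toLp _

theorem coeFn_ofContinuous (a : ℝ) {k : ℝ → ℂ} (hk : Continuous k) :
    ofContinuous a hk =ᵐ[volume.restrict (Ioo (-a) a)] k :=
  MemLp.coeFn_toLp _

theorem continuous_exp (w : ℂ) : Continuous fun x : ℝ => Complex.exp (-Complex.I * w * x) := by
  fun_prop

theorem coeFn_expVec (a : ℝ) (w : ℂ) : expVec a w =ᵐ[volume.restrict (Ioo (-a) a)]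
    fun x : ℝ => Complex.exp (-Complex.I * w * x) :=
  MemLp.coeFn_toLp _

theorem hasDerivAt_exp (w : ℂ) (x : ℝ) : HasDerivAt (fun x : ℝ => Complex.exp (-Complex.I * w * x))
    (-Complex.I * w * Complex.exp (-Complex.I * w * x)) x := by
  have h := ((Complex.ofRealCLM.hasDerivAt (x := x)).const_mul (-Complex.I * w)).cexp
  simp only [Complex.ofRealCLM_apply, Complex.ofReal_one, mul_one] at h
  exact h.congr_deriv (mul_comm _ _)

theorem conj_exp (w : ℂ) (x : ℝ) : conj (Complex.exp (-Complex.I * w * x)) =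
    Complex.exp (-Complex.I * (-conj w) * x) := by
  rw [← Complex.exp_conj]
  simp

theorem inner_eq_setIntegral {a : ℝ} (f g : L2 a) {F G : ℝ → ℂ}
    (hF : f =ᵐ[volume.restrict (Ioo (-a) a)] F) (hG : g =ᵐ[volume.restrict (Ioo (-a) a)] G) :
    inner ℂ f g = ∫ x in Ioo (-a) a, conj (F x) * G x := by
  rw [L2.inner_def]
  refine integral_congr_ae ?_
  filter_upwards [hF, hG] with x hx hx'
  rw [RCLike.inner_apply, hx, hx', mul_comm]

theorem continuousOn_of_acLoc {a : ℝ} {F : ℝ → ℂ} (hF : ACLoc a F) :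
    ContinuousOn F (Ioo (-a) a) := by
  intro x hx
  obtain ⟨c, hc1, hc2⟩ := exists_between hx.1
  obtain ⟨d, hd1, hd2⟩ := exists_between hx.2
  have h := (hF c ⟨hc1, hc2.trans hx.2⟩ d ⟨hx.1.trans hd1, hd2⟩).continuousOn
  rw [uIcc_of_le (hc2.trans hd1).le] at h
  exact (h.continuousAt (Icc_mem_nhds hc2 hd1)).continuousWithinAt

theorem acLoc_of_hasDerivAt (a : ℝ) {k k' : ℝ → ℂ} (hk' : Continuous k')
    (h : ∀ x, HasDerivAt k (k' x) x) : ACLoc a k := by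
  intro c _ d _
  have hk : ContDiff ℝ 1 k := by
    rw [contDiff_one_iff_deriv]
    refine ⟨fun x => (h x).differentiableAt, ?_⟩
    rwa [show deriv k = k' from funext fun x => (h x).deriv]
  exact hk.contDiffOn.absolutelyContinuousOnInterval

/-- A continuous function whose class vanishes at the endpoints has the value zero there. -/
theorem eq_zero_of_mem_vanishing {a : ℝ} (ha : 0 < a) {k : ℝ → ℂ} (hk : Continuous k) {f : L2 a}
    (hf : f ∈ vanishing a) (hfk : f =ᵐ[volume.restrict (Ioo (-a) a)] k) :
    k (-a) = 0 ∧ k a = 0 := by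
  obtain ⟨F, hF, hfF, h1, h2⟩ := hf
  have hEq : EqOn F k (Ioo (-a) a) :=
    Measure.eqOn_open_of_ae_eq (hfF.symm.trans hfk) isOpen_Ioo hF hk.continuousOn
  have haa : -a < a := by linarith
  constructor
  · refine tendsto_nhds_unique ((hk.tendsto (-a)).mono_left nhdsWithin_le_nhds) (h1.congr' ?_)
    filter_upwards [Ioo_mem_nhdsGT haa] with x hx using hEq hx
  · refine tendsto_nhds_unique ((hk.tendsto a).mono_left nhdsWithin_le_nhds) (h2.congr' ?_)
    filter_upwards [Ioo_mem_nhdsLT haa] with x hx using hEq hx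

theorem expVec_ne_zero {a : ℝ} (ha : 0 < a) (w : ℂ) : expVec a w ≠ 0 := by
  intro h
  have h1 := coeFn_expVec a w
  rw [h] at h1
  have hEq : EqOn (fun x : ℝ => Complex.exp (-Complex.I * w * x)) (fun _ => 0) (Ioo (-a) a) :=
    Measure.eqOn_open_of_ae_eq (h1.symm.trans (Lp.coeFn_zero _ _ _)) isOpen_Ioo
      (continuous_exp w).continuousOn continuousOn_const
  exact Complex.exp_ne_zero _ (hEq (show (0 : ℝ) ∈ Ioo (-a) a from ⟨by linarith, ha⟩))

/-! ### The minimal operator and its defect spaces -/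

theorem mem_graph_minOp {a : ℝ} {p : L2 a × L2 a} :
    p ∈ (minOp a).graph ↔ p ∈ maxGraph a ∧ p.1 ∈ vanishing a := by
  have hg : (maxOp a).graph = maxGraph a :=
    Submodule.toLinearPMap_graph_eq _ (maxGraph_singleValued a)
  rw [← hg, LinearPMap.mem_graph_iff, LinearPMap.mem_graph_iff]
  constructor
  · rintro ⟨y, hy1, hy2⟩
    have hy := y.2
    refine ⟨⟨⟨y, hy.2⟩, hy1, ?_⟩, hy1 ▸ hy.1⟩
    rw [← hy2]
    exact (LinearPMap.domRestrict_apply rfl).symm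
  · rintro ⟨⟨y, hy1, hy2⟩, hv⟩
    refine ⟨⟨y, ⟨hy1 ▸ hv, y.2⟩⟩, hy1, ?_⟩
    rw [← hy2]
    exact LinearPMap.domRestrict_apply rfl

theorem ofContinuous_mem_graph_minOp (a : ℝ) {k k' : ℝ → ℂ} (hk : Continuous k)
    (hk' : Continuous k') (h : ∀ x, HasDerivAt k (k' x) x) (h1 : k (-a) = 0) (h2 : k a = 0) :
    (ofContinuous a hk, ofContinuous a (hk'.const_mul Complex.I)) ∈ (minOp a).graph := by
  rw [mem_graph_minOp]
  refine ⟨⟨k, acLoc_of_hasDerivAt a hk' h, coeFn_ofContinuous a hk, ?_⟩,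
    ⟨k, hk.continuousOn, coeFn_ofContinuous a hk, ?_, ?_⟩⟩
  · filter_upwards [coeFn_ofContinuous a (hk'.const_mul Complex.I)] with x hx
    rw [hx, ← mul_assoc, neg_mul, Complex.I_mul_I, neg_neg, one_mul]
    exact h x
  · rw [← h1]
    exact (hk.tendsto (-a)).mono_left nhdsWithin_le_nhds
  · rw [← h2]
    exact (hk.tendsto a).mono_left nhdsWithin_le_nhds

theorem apply_eq_zero_of_tsupport_subset_Ioo {b c : ℝ} {g : ℝ → ℝ} (hg : tsupport g ⊆ Ioo b c) :
    g b = 0 ∧ g c = 0 :=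
  ⟨image_eq_zero_of_notMem_tsupport fun h => lt_irrefl _ (hg h).1,
    image_eq_zero_of_notMem_tsupport fun h => lt_irrefl _ (hg h).2⟩

theorem integrableOn_L2 {a : ℝ} (f : L2 a) : IntegrableOn f (Ioo (-a) a) := by
  have h : MemLp f 2 (volume.restrict (Ioo (-a) a)) := Lp.memLp f
  exact h.integrable (by norm_num)

/-- Smooth functions with compact support in `(-a, a)` lie in the domain, and only the zero class is
orthogonal to all of them. -/
theorem dense_minOp_domain (a : ℝ) : Dense ((minOp a).domain : Set (L2 a)) := by
  rw [Submodule.dense_iff_topologicalClosure_eq_top, Submodule.topologicalClosure_eq_top_iff,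
    Submodule.eq_bot_iff]
  intro f hf
  have h := isOpen_Ioo.ae_eq_zero_of_integral_contDiff_smul_eq_zero
    (integrableOn_L2 f).locallyIntegrableOn ?_
  · rw [Lp.eq_zero_iff_ae_eq_zero]
    exact (ae_restrict_iff' measurableSet_Ioo).2 h
  · intro g hg _ hgs
    have hgc : Continuous fun x => (g x : ℂ) := Complex.continuous_ofReal.comp hg.continuous
    have hg'c : Continuous fun x => ((deriv g x : ℝ) : ℂ) :=
      Complex.continuous_ofReal.comp (hg.continuous_deriv (by simp))
    obtain ⟨hl, hr⟩ := apply_eq_zero_of_tsupport_subset_Ioo hgs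
    have hmem := ofContinuous_mem_graph_minOp a hgc hg'c
      (fun x => ((hg.differentiable (by simp)) x).hasDerivAt.ofReal_comp)
      (by rw [hl, Complex.ofReal_zero]) (by rw [hr, Complex.ofReal_zero])
    have h0 := (Submodule.mem_orthogonal _ _).1 hf _ (LinearPMap.mem_domain_of_mem_graph hmem)
    rw [inner_eq_setIntegral _ _ (coeFn_ofContinuous a hgc) (ae_eq_refl _)] at h0
    rw [← setIntegral_eq_integral_of_forall_compl_eq_zero (s := Ioo (-a) a), ← h0]
    · simp only [Complex.conj_ofReal, Complex.real_smul]
    · intro x hx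
      rw [image_eq_zero_of_notMem_tsupport fun h => hx (hgs h), zero_smul]

/-- This weak form replaces all computations with the adjoint. Density is essential: without it
`adjoint` is a default value. -/
theorem mem_defectSpace_iff {H : Type*} [NormedAddCommGroup H] [InnerProductSpace ℂ H]
    [CompleteSpace H] {T : H →ₗ.[ℂ] H} (hT : Dense (T.domain : Set H)) {w : ℂ} {f : H} :
    f ∈ defectSpace T w ↔ ∀ u v, (u, v) ∈ T.graph → inner ℂ v f = w * inner ℂ u f := by
  rw [defectSpace, LinearPMap.adjoint_graph_eq_graph_adjoint hT, Submodule.mem_comap,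
    Submodule.mem_adjoint_iff]
  change (∀ u v, (u, v) ∈ T.graph → inner ℂ v f - inner ℂ u (w • f) = 0) ↔ _
  simp only [inner_smul_right, sub_eq_zero]

theorem expVec_mem_defectSpace {a : ℝ} (ha : 0 < a) (w : ℂ) :
    expVec a w ∈ defectSpace (minOp a) w := by
  rw [mem_defectSpace_iff (dense_minOp_domain a)]
  intro u v huv
  obtain ⟨⟨F, hF, huF, hd⟩, ⟨G, hG, huG, h1, h2⟩⟩ := mem_graph_minOp.1 huv
  -- The absolutely continuous representative and the one with zero boundary limits are given
  -- separately; by continuity they coincide.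
  have hEq : EqOn G F (Ioo (-a) a) :=
    Measure.eqOn_open_of_ae_eq (huG.symm.trans huF) isOpen_Ioo hG (continuousOn_of_acLoc hF)
  have haa : -a < a := by linarith
  have h1' : Tendsto F (𝓝[>] (-a)) (𝓝 0) := h1.congr' (by
    filter_upwards [Ioo_mem_nhdsGT haa] with x hx using hEq hx)
  have h2' : Tendsto F (𝓝[<] a) (𝓝 0) := h2.congr' (by
    filter_upwards [Ioo_mem_nhdsLT haa] with x hx using hEq hx)
  set e : ℝ → ℂ := fun x => Complex.exp (-Complex.I * (-conj w) * x) with he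
  have hec : Continuous e := continuous_exp _
  have heL : MemLp e 2 (volume.restrict (Ioo (-a) a)) := memLp_of_continuous a hec
  have hint : ∀ f : L2 a, IntegrableOn (fun x => e x * f x) (Ioo (-a) a) := fun f =>
    MemLp.integrable_mul heL (Lp.memLp f)
  have hinner : ∀ f : L2 a, conj (inner ℂ f (expVec a w)) = ∫ x in Ioo (-a) a, e x * f x := by
    intro f
    rw [inner_conj_symm, inner_eq_setIntegral _ _ (coeFn_expVec a w) (ae_eq_refl _)]
    simp_rw [conj_exp]
    rfl
  -- Integration by parts: `e` is the conjugate of `e^{-iwx}`, and the boundary terms vanish because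
  -- `F` does.
  have hzero := setIntegral_eq_zero_of_ae_hasDerivAt ha (P := fun x => e x • F x)
    (q := fun x => Complex.I * conj w * (e x * u x) - Complex.I * (e x * v x))
    (fun c hc d hd => ((acLoc_of_hasDerivAt a (continuous_const.mul hec)
      (hasDerivAt_exp (-conj w))) c hc d hd).smul (hF c hc d hd))
    (((hint u).const_mul _).sub ((hint v).const_mul _)) ?_ ?_ ?_
  · rw [integral_sub ((hint u).const_mul _) ((hint v).const_mul _), integral_const_mul,
      integral_const_mul, ← hinner, ← hinner, mul_assoc, ← mul_sub, mul_eq_zero, sub_eq_zero,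
      ← map_mul] at hzero
    exact (starRingEnd ℂ).injective (hzero.resolve_left Complex.I_ne_zero).symm
  · filter_upwards [hd, huF] with x hx hux
    have h := (hasDerivAt_exp (-conj w) x).mul hx
    rw [hux]
    refine h.congr_deriv ?_
    simp only [he]
    ring
  · have h := ((hec.tendsto (-a)).mono_left nhdsWithin_le_nhds).smul h1'
    rwa [smul_zero] at h
  · have h := ((hec.tendsto a).mono_left nhdsWithin_le_nhds).smul h2'
    rwa [smul_zero] at h

/-- A du Bois-Reymond argument: `G = e^{iwx} f` has weak derivative zero, hence equals its mean `M`
almost everywhere. -/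
theorem defectSpace_minOp_le {a : ℝ} (ha : 0 < a) (w : ℂ) :
    defectSpace (minOp a) w ≤ Submodule.span ℂ {expVec a w} := by
  intro f hf
  rw [mem_defectSpace_iff (dense_minOp_domain a)] at hf
  have haa : -a < a := by linarith
  set G : ℝ → ℂ := fun x => Complex.exp (-Complex.I * (-w) * x) * f x with hG
  have hGint : IntegrableOn G (Ioo (-a) a) :=
    MemLp.integrable_mul (memLp_of_continuous a (continuous_exp (-w))) (Lp.memLp f)
  set M : ℂ := (1 / (2 * a) : ℝ) * ∫ x in Ioo (-a) a, G x with hM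
  have hae := isOpen_Ioo.ae_eq_zero_of_integral_contDiff_smul_eq_zero (μ := volume)
    (f := fun x => G x - M) (U := Ioo (-a) a)
    (hGint.sub (integrableOn_const (by simp))).locallyIntegrableOn ?_
  · rw [Submodule.mem_span_singleton]
    refine ⟨M, ?_⟩
    apply Lp.ext
    filter_upwards [Lp.coeFn_smul M (expVec a w), coeFn_expVec a w,
      (ae_restrict_iff' measurableSet_Ioo).2 hae] with x h1 h2 h3
    rw [h1, Pi.smul_apply, h2, smul_eq_mul, ← sub_eq_zero.1 h3, hG]
    simp only
    rw [mul_right_comm, ← Complex.exp_add]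
    simp
  · intro g hg _ hgs
    have hgi : IntegrableOn g (Ioo (-a) a) :=
      (hg.continuous.integrableOn_Icc).mono_set Ioo_subset_Icc_self
    -- Subtracting the mean makes the primitive `Φ` of `φ` vanish at both ends, so `e Φ` is in the
    -- domain of `L₁`. Testing `f` against it cancels the terms with `Φ` and leaves `∫ φ G = 0`,
    -- which is `∫ g (G - M) = 0`.
    set m : ℝ := 1 / (2 * a) * ∫ x in Ioo (-a) a, g x with hm
    set φ : ℝ → ℝ := fun x => g x - m with hφ
    have hφc : Continuous φ := hg.continuous.sub continuous_const
    have hvol : volume.real (Ioo (-a) a) = 2 * a := by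
      rw [Real.volume_real_Ioo_of_le haa.le]
      ring
    have hφ0 : ∫ x in (-a)..a, φ x = 0 := by
      rw [intervalIntegral.integral_of_le haa.le, integral_Ioc_eq_integral_Ioo,
        integral_sub hgi (integrableOn_const (by simp)), setIntegral_const, hvol, hm, smul_eq_mul]
      field_simp
      ring
    set Φ : ℝ → ℝ := fun x => ∫ t in (-a)..x, φ t with hΦ
    have hΦd : ∀ x, HasDerivAt Φ (φ x) x := fun x =>
      intervalIntegral.integral_hasDerivAt_right (hφc.intervalIntegrable _ _)
        (hφc.stronglyMeasurableAtFilter _ _) hφc.continuousAt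
    have hΦc : Continuous Φ := continuous_iff_continuousAt.2 fun x => (hΦd x).continuousAt
    set e : ℝ → ℂ := fun x => Complex.exp (-Complex.I * conj w * x) with he
    have hec : Continuous e := continuous_exp _
    have hkc : Continuous fun x => e x * (Φ x : ℂ) :=
      hec.mul (Complex.continuous_ofReal.comp hΦc)
    have hk'c : Continuous fun x => -Complex.I * conj w * e x * (Φ x : ℂ) + e x * (φ x : ℂ) :=
      ((continuous_const.mul hec).mul (Complex.continuous_ofReal.comp hΦc)).add
        (hec.mul (Complex.continuous_ofReal.comp hφc))
    have hmem := ofContinuous_mem_graph_minOp a hkc hk'c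
      (fun x => (hasDerivAt_exp (conj w) x).mul (hΦd x).ofReal_comp)
      (by simp [hΦ]) (by simp only [hΦ, hφ0, Complex.ofReal_zero, mul_zero])
    have h := hf _ _ hmem
    rw [inner_eq_setIntegral _ _ (coeFn_ofContinuous a _) (ae_eq_refl _),
      inner_eq_setIntegral _ _ (coeFn_ofContinuous a _) (ae_eq_refl _), ← integral_const_mul,
      ← sub_eq_zero, ← integral_sub] at h
    · have hconj : ∀ x, conj (e x) = Complex.exp (-Complex.I * (-w) * x) := fun x => by
        rw [he, conj_exp, Complex.conj_conj]
      have h' : ∫ x in Ioo (-a) a, -Complex.I * ((φ x : ℂ) * G x) = 0 := by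
        rw [← h]
        refine integral_congr_ae (Eventually.of_forall fun x => ?_)
        simp only [map_mul, map_add, map_neg, Complex.conj_I, Complex.conj_conj,
          Complex.conj_ofReal, hconj, hG]
        linear_combination (w * Complex.exp (-Complex.I * (-w) * x) * Φ x * f x) * Complex.I_sq
      rw [integral_const_mul, mul_eq_zero] at h'
      have h'' := h'.resolve_left (neg_ne_zero.2 Complex.I_ne_zero)
      rw [← setIntegral_eq_integral_of_forall_compl_eq_zero (s := Ioo (-a) a)]
      · have hgG : IntegrableOn (fun x => (g x : ℂ) * G x) (Ioo (-a) a) := by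
          have := MemLp.integrable_mul (memLp_of_continuous a ((Complex.continuous_ofReal.comp
            hg.continuous).mul (continuous_exp (-w)))) (Lp.memLp f)
          refine this.congr (Eventually.of_forall fun x => ?_)
          simp [hG, mul_assoc]
        have e1 : ∀ x, (φ x : ℂ) * G x = (g x : ℂ) * G x - (m : ℂ) * G x := fun x => by
          simp only [hφ]
          push_cast
          ring
        simp_rw [e1] at h''
        rw [integral_sub hgG (hGint.const_mul _), integral_const_mul, sub_eq_zero] at h''
        have hgM : IntegrableOn (fun x => (g x : ℂ) * M) (Ioo (-a) a) := hgi.ofReal.mul_const M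
        simp_rw [smul_sub, Complex.real_smul]
        rw [integral_sub hgG hgM, h'', integral_mul_const, hM, hm,
          integral_complex_ofReal]
        push_cast
        ring
      · intro x hx
        rw [image_eq_zero_of_notMem_tsupport fun h => hx (hgs h), zero_smul]
    · exact ((memLp_of_continuous a (Complex.continuous_conj.comp
        (hk'c.const_mul Complex.I))).integrable_mul (Lp.memLp f))
    · exact ((memLp_of_continuous a (Complex.continuous_conj.comp
        hkc)).integrable_mul (Lp.memLp f)).const_mul w

theorem isDefectBasis_minOp {a : ℝ} (ha : 0 < a) : IsDefectBasis (minOp a) (expVec a) :=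
  ⟨dense_minOp_domain a, fun w _ => ⟨expVec_ne_zero ha w, le_antisymm (defectSpace_minOp_le ha w)
    ((Submodule.span_singleton_le_iff_mem _ _).2 (expVec_mem_defectSpace ha w))⟩⟩

/-! ### The characteristic function and the parameter of an extension -/

/-- The product form avoids a division and so covers `w = conj z`, in particular the point `w = i`
where `B` vanishes. -/
theorem mul_inner_expVec {a : ℝ} (ha : 0 < a) (z w : ℂ) :
    (w - conj z) * inner ℂ (expVec a z) (expVec a w) = 2 * Complex.sin ((w - conj z) * a) := by
  rw [inner_eq_setIntegral _ _ (coeFn_expVec a z) (coeFn_expVec a w)]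
  by_cases h : w - conj z = 0
  · simp [h]
  have hc : -Complex.I * (w - conj z) ≠ 0 := mul_ne_zero (neg_ne_zero.2 Complex.I_ne_zero) h
  have e : ∀ x : ℝ, conj (Complex.exp (-Complex.I * z * x)) * Complex.exp (-Complex.I * w * x) =
      Complex.exp (-Complex.I * (w - conj z) * x) := fun x => by
    rw [conj_exp, ← Complex.exp_add]
    ring_nf
  simp_rw [e]
  rw [← integral_Ioc_eq_integral_Ioo, ← intervalIntegral.integral_of_le (by linarith),
    integral_exp_mul_complex hc, Complex.sin]
  have e1 : -Complex.I * (w - conj z) * (a : ℝ) = -((w - conj z) * a) * Complex.I := by ring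
  have e2 : -Complex.I * (w - conj z) * ((-a : ℝ) : ℂ) = (w - conj z) * a * Complex.I := by
    push_cast
    ring
  rw [e1, e2]
  field_simp
  rw [Complex.I_sq]
  ring

theorem norm_expVec_neg_I {a : ℝ} (ha : 0 < a) :
    ‖expVec a (-Complex.I)‖ = ‖expVec a Complex.I‖ := by
  have h1 := mul_inner_expVec ha Complex.I Complex.I
  have h2 := mul_inner_expVec ha (-Complex.I) (-Complex.I)
  rw [Complex.conj_I, sub_neg_eq_add, inner_self_eq_norm_sq_to_K] at h1
  rw [map_neg, Complex.conj_I, neg_neg, ← neg_add', neg_mul, neg_mul, Complex.sin_neg, mul_neg,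
    neg_inj, ← h1, inner_self_eq_norm_sq_to_K] at h2
  have h3 := mul_left_cancel₀ (by simp [← two_mul]) h2
  have h4 : ‖expVec a (-Complex.I)‖ ^ 2 = ‖expVec a Complex.I‖ ^ 2 := by exact_mod_cast h3
  exact (sq_eq_sq₀ (norm_nonneg _) (norm_nonneg _)).1 h4

theorem livsic_expVec {a : ℝ} (ha : 0 < a) {w : ℂ} (hw : 0 < w.im) :
    livsic (expVec a) w =
      Complex.sin ((w - Complex.I) * a) / Complex.sin ((w + Complex.I) * a) := by
  have h1 := mul_inner_expVec ha Complex.I w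
  have h2 := mul_inner_expVec ha (-Complex.I) w
  rw [Complex.conj_I, sub_neg_eq_add] at h1
  rw [map_neg, Complex.conj_I, neg_neg] at h2
  have hn : (‖expVec a Complex.I‖ : ℂ) ≠ 0 :=
    Complex.ofReal_ne_zero.2 (norm_ne_zero_iff.2 (expVec_ne_zero ha _))
  have hs := sin_ne_zero_of_im_pos (im_add_I_mul_pos ha hw)
  have hX : (w + Complex.I) * inner ℂ (expVec a Complex.I) (expVec a w) ≠ 0 := by
    rw [h1]
    exact mul_ne_zero two_ne_zero hs
  have hX1 := left_ne_zero_of_mul hX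
  have hX2 := right_ne_zero_of_mul hX
  have hconj : (starRingEnd ℂ) (‖expVec a Complex.I‖⁻¹ : ℂ) = (‖expVec a Complex.I‖⁻¹ : ℂ) := by
    rw [map_inv₀, Complex.conj_ofReal]
  rw [livsic, gram, gram, unitDefect, unitDefect, inner_smul_left, inner_smul_left,
    norm_expVec_neg_I ha, hconj]
  rw [show Complex.sin ((w - Complex.I) * a) / Complex.sin ((w + Complex.I) * a) =
    (2 * Complex.sin ((w - Complex.I) * a)) / (2 * Complex.sin ((w + Complex.I) * a)) from
    (mul_div_mul_left _ _ two_ne_zero).symm, ← h1, ← h2]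
  field_simp

/-- The function `A e^{-x} + C e^{x}` vanishes at `±a`, a linear system with determinant `e^{2a} -
e^{-2a} ≠ 0`. This is the directness of von Neumann's sum of `dom L₁` and the defect spaces at `±i`.
-/
theorem eq_zero_of_add_mem_vanishing {a : ℝ} (ha : 0 < a) {A C : ℂ}
    (h : A • expVec a (-Complex.I) + C • expVec a Complex.I ∈ vanishing a) : A = 0 ∧ C = 0 := by
  have hk : Continuous fun x : ℝ => A * Complex.exp (-Complex.I * (-Complex.I) * x) +
      C * Complex.exp (-Complex.I * Complex.I * x) :=
    ((continuous_exp _).const_mul A).add ((continuous_exp _).const_mul C)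
  obtain ⟨h1, h2⟩ := eq_zero_of_mem_vanishing ha hk h (by
    filter_upwards [Lp.coeFn_add (A • expVec a (-Complex.I)) (C • expVec a Complex.I),
      Lp.coeFn_smul A (expVec a (-Complex.I)), Lp.coeFn_smul C (expVec a Complex.I),
      coeFn_expVec a (-Complex.I), coeFn_expVec a Complex.I] with x e1 e2 e3 e4 e5
    rw [e1, Pi.add_apply, e2, e3, Pi.smul_apply, Pi.smul_apply, e4, e5, smul_eq_mul, smul_eq_mul])
  have hI : Complex.I * Complex.I = -1 := Complex.I_mul_I
  simp only [mul_neg, neg_mul, hI, one_mul, neg_neg, Complex.ofReal_neg] at h1 h2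
  have hne : Complex.exp a * Complex.exp a - Complex.exp (-a) * Complex.exp (-a) ≠ 0 := by
    rw [← Complex.exp_add, ← Complex.exp_add, sub_ne_zero]
    norm_cast
    rw [Real.exp_eq_exp]
    intro h
    linarith
  constructor
  · refine (mul_eq_zero.1 (?_ : A * _ = 0)).resolve_right hne
    linear_combination Complex.exp a * h1 - Complex.exp (-a) * h2
  · refine (mul_eq_zero.1 (?_ : C * _ = 0)).resolve_right hne
    linear_combination Complex.exp a * h2 - Complex.exp (-a) * h1

theorem unitDefect_mem_adjoint_domain {a : ℝ} (ha : 0 < a) (w : ℂ) :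
    unitDefect (expVec a) w ∈ (minOp a).adjoint.domain :=
  Submodule.smul_mem _ _ (LinearPMap.mem_domain_of_mem_graph
    (Submodule.mem_comap.1 (expVec_mem_defectSpace ha w)))

theorem extension_minOp_injective {a : ℝ} (ha : 0 < a) {α β : ℂ}
    (h : extension (minOp a) (expVec a) α = extension (minOp a) (expVec a) β) : α = β := by
  have hmem : α • unitDefect (expVec a) (-Complex.I) - unitDefect (expVec a) Complex.I ∈
      (extension (minOp a) (expVec a) α).domain :=
    ⟨Submodule.mem_sup_right (Submodule.mem_span_singleton_self _),
      Submodule.sub_mem _ (Submodule.smul_mem _ _ (unitDefect_mem_adjoint_domain ha _))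
        (unitDefect_mem_adjoint_domain ha _)⟩
  rw [h] at hmem
  obtain ⟨d, hd, v, hv, hdv⟩ := Submodule.mem_sup.1 hmem.1
  obtain ⟨k, rfl⟩ := Submodule.mem_span_singleton.1 hv
  have hd' : d ∈ vanishing a := hd.1
  set n : ℂ := (‖expVec a (-Complex.I)‖⁻¹ : ℂ) with hn
  set m : ℂ := (‖expVec a Complex.I‖⁻¹ : ℂ) with hm
  have hn0 : n ≠ 0 := inv_ne_zero (Complex.ofReal_ne_zero.2
    (norm_ne_zero_iff.2 (expVec_ne_zero ha _)))
  have hm0 : m ≠ 0 := inv_ne_zero (Complex.ofReal_ne_zero.2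
    (norm_ne_zero_iff.2 (expVec_ne_zero ha _)))
  -- The element `d` of `dom L₁` is also a combination of the two defect vectors, so both
  -- coefficients vanish: `k = 1`, and then `α = β`.
  have hdeq : d = ((α - k * β) * n) • expVec a (-Complex.I) + ((k - 1) * m) • expVec a Complex.I := by
    rw [eq_sub_of_add_eq hdv, unitDefect, unitDefect]
    module
  rw [hdeq] at hd'
  obtain ⟨h1, h2⟩ := eq_zero_of_add_mem_vanishing ha hd'
  have hk : k = 1 := sub_eq_zero.1 ((mul_eq_zero.1 h2).resolve_right hm0)
  have hα := (mul_eq_zero.1 h1).resolve_right hn0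
  rwa [hk, one_mul, sub_eq_zero] at hα

theorem isClarkMeasureOf_extension_iff {a : ℝ} (ha : 0 < a) {α : ℂ} (hα : ‖α‖ = 1)
    (μ : Measure ℝ) :
    IsClarkMeasureOf (minOp a) (expVec a) (extension (minOp a) (expVec a) α) μ ↔
      IsClarkMeasure (livsic (expVec a)) α μ := by
  refine ⟨?_, fun h => ⟨isDefectBasis_minOp ha, α, hα, rfl, h⟩⟩
  rintro ⟨_, β, _, hβ, h⟩
  rwa [extension_minOp_injective ha hβ]

/-- The Clark measure of the extension `L_{1,α}` of the minimal operator. -/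
theorem exists_isClarkMeasureOf_iff_eq_latticeMeasure {a : ℝ} (ha : 0 < a) {α : ℂ}
    (hα : ‖α‖ = 1) :
    ∃ p δ : ℝ, 0 < p ∧
      (∀ μ, IsClarkMeasureOf (minOp a) (expVec a) (extension (minOp a) (expVec a) α) μ ↔
        μ = latticeMeasure a p δ) ∧
      (α ≠ 1 → range (latticePoint a δ) = {s : ℝ | ∃ n : ℤ, (s : ℂ) =
        1 / a * Complex.arctan ((star α + 1) / (star α - 1) * Complex.tan (Complex.I * a))
          + n * Real.pi / a}) ∧
      (α = 1 → δ = Real.pi / 2) := by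
  have hsh : 0 < Real.sinh a := Real.sinh_pos_iff.2 ha
  have hch : 0 < Real.cosh a := Real.cosh_pos a
  by_cases h1 : α = 1
  · subst h1
    refine ⟨Real.cosh a / Real.sinh a, Real.pi / 2, by positivity, fun μ => ?_,
      fun h => absurd rfl h, fun _ => rfl⟩
    rw [isClarkMeasureOf_extension_iff ha hα]
    refine isClarkMeasure_iff_eq_latticeMeasure ha (by positivity) (fun w hw => ?_) μ
    rw [livsic_expVec ha hw, star_one, re_cayley_of_eq_one ha hw]
  · have hβ : star α ≠ 1 := fun h => h1 (star_injective (h.trans (star_one ℂ).symm))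
    obtain ⟨r, hr⟩ := exists_ofReal_eq_cayley_mul_tan a (β := star α) (by rw [norm_star, hα])
    have hT : 0 < Real.tanh a := by
      rw [Real.tanh_eq_sinh_div_cosh]
      positivity
    refine ⟨(Real.tanh a + r ^ 2 / Real.tanh a) / (1 + r ^ 2), Real.arctan r, by positivity,
      fun μ => ?_, fun _ => range_latticePoint_arctan hr, fun h => absurd h h1⟩
    rw [isClarkMeasureOf_extension_iff ha hα]
    refine isClarkMeasure_iff_eq_latticeMeasure ha (by positivity) (fun w hw => ?_) μ
    rw [livsic_expVec ha hw, re_cayley_of_ne_one ha hβ hr hw]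

end ClarkInterval

end

theorem mainTheorem8 (a : ℝ) (ha : 0 < a) :
    -- the functions `e^{-iwx}` are a basis of the defect spaces of `L₁`
    ClarkInterval.IsDefectBasis (ClarkInterval.minOp a) (ClarkInterval.expVec a) ∧
    -- the characteristic function of `L₁`
    (∀ w : ℂ, 0 < w.im →
      Complex.sin ((w + Complex.I) * a) ≠ 0 ∧
      ClarkInterval.livsic (ClarkInterval.expVec a) w =
        Complex.sin ((w - Complex.I) * a) / Complex.sin ((w + Complex.I) * a)) ∧
    -- the extension `L_{1,α}` has exactly one Clark measure, and its point masses are as stated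
    ∀ α : ℂ, ‖α‖ = 1 →
      (∃! μ : MeasureTheory.Measure ℝ,
        ClarkInterval.IsClarkMeasureOf (ClarkInterval.minOp a) (ClarkInterval.expVec a)
          (ClarkInterval.extension (ClarkInterval.minOp a) (ClarkInterval.expVec a) α) μ) ∧
      ∀ μ : MeasureTheory.Measure ℝ,
        ClarkInterval.IsClarkMeasureOf (ClarkInterval.minOp a) (ClarkInterval.expVec a)
          (ClarkInterval.extension (ClarkInterval.minOp a) (ClarkInterval.expVec a) α) μ →
        (α ≠ 1 →
          {s : ℝ | μ {s} ≠ 0} =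
            {s : ℝ | ∃ n : ℤ, (s : ℂ) =
              1 / a * Complex.arctan ((star α + 1) / (star α - 1) * Complex.tan (Complex.I * a))
                + n * Real.pi / a}) ∧
        (α = 1 → ∀ θ : ℝ, (θ = Real.pi / 2 ∨ θ = -(Real.pi / 2)) →
          {s : ℝ | μ {s} ≠ 0} = {s : ℝ | ∃ n : ℤ, s = 1 / a * θ + n * Real.pi / a}) := by
  refine ⟨ClarkInterval.isDefectBasis_minOp ha, fun w hw =>
    ⟨ClarkInterval.sin_ne_zero_of_im_pos (ClarkInterval.im_add_I_mul_pos ha hw),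
      ClarkInterval.livsic_expVec ha hw⟩, fun α hα => ?_⟩
  obtain ⟨p, δ, hp, hiff, hne, heq⟩ :=
    ClarkInterval.exists_isClarkMeasureOf_iff_eq_latticeMeasure ha hα
  refine ⟨⟨ClarkInterval.latticeMeasure a p δ, (hiff _).2 rfl, fun μ hμ => (hiff μ).1 hμ⟩,
    fun μ hμ => ?_⟩
  rw [(hiff μ).1 hμ, ClarkInterval.setOf_latticeMeasure_singleton_ne_zero ha hp]
  refine ⟨hne, fun h1 θ hθ => ?_⟩
  rw [heq h1]
  exact ClarkInterval.range_latticePoint_pi_div_two hθ
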